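/- A \emph{grid path} is a finite path consisting of consecutive edges of the rectangular grid on $\mathbb{Z}^2$ that uses no grid-edge twice (it may pass through a grid-point several times). A \emph{bend} of a grid path is a point where a horizontal grid-edge of the path is followed by a vertical one or vice versa. A \emph{$k$-bend representation} of a simple graph $G$ assigns to every vertex a grid path with at most $k$ bends such that two distinct vertices are adjacent if and only if their paths share at least one grid-edge. The \emph{bend-number} $b(G)$ is the minimum $k\ge 0$ such that $G$ has a $k$-bend representation. Then the following hold. \begin{enumerate} \item For every integer $m\ge 3$, the complete bipartite graph $K_{m,m}$ satisfies $b(K_{m,m})=\lceil m/2\rceil$. \item For all integers $3\le m\le n$ and $k\ge 0$, if $K_{m,n}$ has a $k$-bend representation, then $(k+1)(m+n)\ \ge\ mn+\sqrt{2k(m+n)}$. \item For every integer $k\ge 0$ there is a finite simple graph $G$ with $b(G)=k$. \end{enumerate} -/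

import Mathlib

/-- The rectangular grid in the plane: its grid-points are the points of `ℤ × ℤ`, and its
grid-edges join points that differ by exactly one in exactly one coordinate. -/
noncomputable def planeGrid : SimpleGraph (ℤ × ℤ) :=
  (SimpleGraph.hasse ℤ).boxProd (SimpleGraph.hasse ℤ)

/-- A finite path in the plane grid, consisting of consecutive grid-edges. No grid-edge is used
twice, but the path may pass through a grid-point more than once (it may cross itself). -/
structure GridPath where
  source : ℤ × ℤ
  target : ℤ × ℤ
  walk : planeGrid.Walk source target
  isTrail : walk.IsTrail

namespace GridPath

/-- The set of grid-edges of a grid path. -/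
def edgeSet (P : GridPath) : Set (Sym2 (ℤ × ℤ)) := {e | e ∈ P.walk.edges}

/-- A traversed grid-edge is horizontal if its two ends have the same second coordinate
(otherwise it is vertical). -/
noncomputable def isHorizontal (d : planeGrid.Dart) : Bool := decide (d.fst.2 = d.snd.2)

/-- The number of bends of a grid path: the number of pairs of consecutive grid-edges along the
path one of which is horizontal and the other vertical. -/
noncomputable def bends (P : GridPath) : ℕ :=
  (P.walk.darts.zip P.walk.darts.tail).countP
    (fun p => isHorizontal p.1 != isHorizontal p.2)

end GridPath

/-- `P` is a `k`-bend representation of `G`: every vertex is assigned a grid path with at most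
`k` bends, and two distinct vertices are adjacent if and only if their paths share a grid-edge. -/
def IsBendRepresentation {V : Type*} (G : SimpleGraph V) (k : ℕ) (P : V → GridPath) : Prop :=
  (∀ v, (P v).bends ≤ k) ∧
    ∀ v w, v ≠ w → (G.Adj v w ↔ ((P v).edgeSet ∩ (P w).edgeSet).Nonempty)

/-- The bend-number of `G`: the minimum `k` such that `G` has a `k`-bend representation
(with value `⊤` if there is no such `k`). -/
noncomputable def bendNumber {V : Type*} (G : SimpleGraph V) : ℕ∞ :=
  ⨅ k ∈ {k : ℕ | ∃ P : V → GridPath, IsBendRepresentation G k P}, (k : ℕ∞)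

/-! ### Grid-edges encoded by an end and a direction -/

open Finset

/-! Lower bound. In a representation of $K_{m,n}$ the paths of one side are pairwise edge-disjoint,
and each meets every path of the other side. A nonempty path has `bends + 1` more edges than
straight passages, and the common edges of two meeting paths outnumber their common straight
passages (`card_straights_inter_lt`). Let $B$ be the total number of bends and $D$ the number of
used edges beyond whose right or upper end no path goes straight on. Inclusion–exclusion gives $D +
mn \le B + m + n$.

Conversely $D$ is large: each of the $l$ used grid-lines contributes its last edge, and each crowded
point two further edges (`card_lines_add_le`). Bends lie where a used vertical line crosses a used
horizontal one, at most two per crossing, or four if crowded (`card_bends_le`). Hence $2B \le D^2$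
(`exists_surplus`), which yields the square root in the bound.

Upper bound. $2k$ ascending and $2k$ descending staircases with steps of length two, $k$ bends each,
represent $K_{2k,2k}$ (`exists_isBendRepresentation`). Together the bounds determine $b(K_{m,m})$,
and even $m$ supplies every bend-number from 2 on. -/

lemma planeGrid_adj_iff (p q : ℤ × ℤ) : planeGrid.Adj p q ↔
    ((p.1 + 1 = q.1 ∨ q.1 + 1 = p.1) ∧ p.2 = q.2) ∨
      ((p.2 + 1 = q.2 ∨ q.2 + 1 = p.2) ∧ p.1 = q.1) := by
  simp [planeGrid, SimpleGraph.boxProd_adj, SimpleGraph.hasse_adj, Order.covBy_iff_add_one_eq]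

/-- The unit vector of a direction (`true` is horizontal, `false` is vertical). -/
def unitVec (d : Bool) : ℤ × ℤ := if d then (1, 0) else (0, 1)

/-- The slot of the grid-edge `pq`: its right or upper end, together with its direction. -/
def slot (p q : ℤ × ℤ) : (ℤ × ℤ) × Bool :=
  if p.2 = q.2 then ((max p.1 q.1, p.2), true) else ((p.1, max p.2 q.2), false)

lemma slot_eq_iff {p q p' q' : ℤ × ℤ} (h : planeGrid.Adj p q) (h' : planeGrid.Adj p' q') :
    slot p q = slot p' q' ↔ s(p, q) = s(p', q') := by
  rw [planeGrid_adj_iff] at h h'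
  obtain ⟨a, b⟩ := p
  obtain ⟨c, d⟩ := q
  obtain ⟨a', b'⟩ := p'
  obtain ⟨c', d'⟩ := q'
  simp only [slot, Sym2.eq_iff, Prod.mk.injEq] at *
  split_ifs <;> simp only [Prod.mk.injEq, and_true, and_false, Bool.true_eq_false, Bool.false_eq_true, false_iff] <;> omega

lemma slot_snd (p q : ℤ × ℤ) : (slot p q).2 = decide (p.2 = q.2) := by
  unfold slot; split_ifs <;> simp [*]

lemma slot_comm (p q : ℤ × ℤ) (h : planeGrid.Adj p q) : slot p q = slot q p :=
  (slot_eq_iff h h.symm).2 Sym2.eq_swap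

/-- The two slots of direction `d` at the grid-point `p`. -/
def incident (p : ℤ × ℤ) (d : Bool) : Finset ((ℤ × ℤ) × Bool) := {(p, d), (p + unitVec d, d)}

lemma slot_mem_incident {p q : ℤ × ℤ} (h : planeGrid.Adj p q) :
    slot p q ∈ incident p (slot p q).2 := by
  rw [planeGrid_adj_iff] at h
  obtain ⟨a, b⟩ := p
  obtain ⟨c, d⟩ := q
  dsimp only at h
  by_cases hbd : b = d
  · simp [slot, incident, unitVec, hbd] at h ⊢
    omega
  · simp [slot, incident, unitVec, hbd] at h ⊢
    omega

/-! ### Edges, bends and straight passages of one path -/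

namespace GridPath

/-- The `i`-th grid-point of a grid path. -/
noncomputable def pt (P : GridPath) (i : ℕ) : ℤ × ℤ := P.walk.getVert i

/-- The number of grid-edges of a grid path. -/
noncomputable def len (P : GridPath) : ℕ := P.walk.length

/-- The slot of the `i`-th grid-edge of a grid path. -/
noncomputable def step (P : GridPath) (i : ℕ) : (ℤ × ℤ) × Bool := slot (P.pt i) (P.pt (i + 1))

lemma adj_pt (P : GridPath) {i : ℕ} (h : i < P.len) : planeGrid.Adj (P.pt i) (P.pt (i + 1)) :=
  P.walk.adj_getVert_succ h

lemma edges_eq {u v : ℤ × ℤ} (w : planeGrid.Walk u v) :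
    w.edges = (List.range w.length).map fun i => s(w.getVert i, w.getVert (i + 1)) := by
  induction w with
  | nil => simp
  | cons h w ih =>
    simp [ih, List.range_succ_eq_map, Function.comp_def]

lemma step_injective (P : GridPath) {i j : ℕ} (hi : i < P.len) (hj : j < P.len)
    (h : P.step i = P.step j) : i = j := by
  have := P.isTrail.edges_nodup
  rw [edges_eq] at this
  have h2 := (List.nodup_map_iff_inj_on List.nodup_range).1 this
  exact h2 i (List.mem_range.2 hi) j (List.mem_range.2 hj)
    ((slot_eq_iff (P.adj_pt hi) (P.adj_pt hj)).1 h)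

/-- The slots of the grid-edges of a grid path. -/
noncomputable def slots (P : GridPath) : Finset ((ℤ × ℤ) × Bool) := (range P.len).image P.step

lemma card_slots (P : GridPath) : P.slots.card = P.len := by
  rw [slots, card_image_of_injOn, card_range]
  intro i hi j hj h
  exact P.step_injective (by simpa using hi) (by simpa using hj) h

lemma mem_edgeSet (P : GridPath) (e : Sym2 (ℤ × ℤ)) :
    e ∈ P.edgeSet ↔ ∃ i < P.len, s(P.pt i, P.pt (i + 1)) = e := by
  simp [edgeSet, edges_eq, pt, len]

lemma mem_slots {P : GridPath} {e : (ℤ × ℤ) × Bool} :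
    e ∈ P.slots ↔ ∃ i < P.len, P.step i = e := by
  simp [slots]

lemma edgeSet_inter_nonempty_iff (P Q : GridPath) :
    (P.edgeSet ∩ Q.edgeSet).Nonempty ↔ (P.slots ∩ Q.slots).Nonempty := by
  constructor
  · rintro ⟨e, h1, h2⟩
    obtain ⟨i, hi, rfl⟩ := (P.mem_edgeSet e).1 h1
    obtain ⟨j, hj, h⟩ := (Q.mem_edgeSet _).1 h2
    exact ⟨P.step i, mem_inter.2 ⟨mem_slots.2 ⟨i, hi, rfl⟩,
      mem_slots.2 ⟨j, hj, (slot_eq_iff (Q.adj_pt hj) (P.adj_pt hi)).2 h⟩⟩⟩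
  · rintro ⟨e, h⟩
    obtain ⟨h1, h2⟩ := mem_inter.1 h
    obtain ⟨i, hi, rfl⟩ := mem_slots.1 h1
    obtain ⟨j, hj, h⟩ := mem_slots.1 h2
    exact ⟨_, (P.mem_edgeSet _).2 ⟨i, hi, rfl⟩, (Q.mem_edgeSet _).2
      ⟨j, hj, (slot_eq_iff (Q.adj_pt hj) (P.adj_pt hi)).1 h⟩⟩

/-- The positions of the bends of a grid path: `i` stands for the grid-point `P.pt (i + 1)`. -/
noncomputable def bendIdx (P : GridPath) : Finset ℕ :=
  {i ∈ range (P.len - 1) | (P.step i).2 ≠ (P.step (i + 1)).2}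

/-- The positions at which a grid path goes straight on. -/
noncomputable def straightIdx (P : GridPath) : Finset ℕ :=
  {i ∈ range (P.len - 1) | (P.step i).2 = (P.step (i + 1)).2}

lemma darts_map_isHorizontal {u v : ℤ × ℤ} (w : planeGrid.Walk u v) :
    w.darts.map isHorizontal =
      (List.range w.length).map fun i => (slot (w.getVert i) (w.getVert (i + 1))).2 := by
  induction w with
  | nil => simp
  | cons h w ih =>
    simp [ih, List.range_succ_eq_map, Function.comp_def, slot_snd, isHorizontal]
    exact fun _ _ => rfl

lemma bends_eq (P : GridPath) : P.bends = P.bendIdx.card := by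
  have key : P.bends = ((P.walk.darts.map isHorizontal).zip
      (P.walk.darts.map isHorizontal).tail).countP fun p => p.1 != p.2 := by
    rw [bends, ← List.map_tail, List.zip_map, List.countP_map]
    rfl
  rw [key, darts_map_isHorizontal]
  have : ∀ (n : ℕ) (g : ℕ → Bool), ((((List.range n).map g).zip
      ((List.range n).map g).tail).countP fun p => p.1 != p.2) =
      #{i ∈ range (n - 1) | g i ≠ g (i + 1)} := by
    intro n g
    have h : ((List.range n).map g).zip ((List.range n).map g).tail =
        (List.range (n - 1)).map fun i => (g i, g (i + 1)) := by
      apply List.ext_getElem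
      · simp
      · intro i h1 h2
        simp
    rw [h, List.countP_map, List.countP_eq_length_filter, card_def, filter_val, range_val,
      Multiset.range, Multiset.filter_coe, Multiset.coe_card]
    congr 1
    apply List.filter_congr
    intro i _
    simp [Function.comp, bne]
    by_cases g i = g (i+1) <;> simp [*]
  exact this _ _

lemma card_bendIdx_add (P : GridPath) : P.bendIdx.card + P.straightIdx.card = P.len - 1 := by
  have := card_filter_add_card_filter_not (s := range (P.len - 1))
    (fun i => (P.step i).2 ≠ (P.step (i + 1)).2)
  simpa [bendIdx, straightIdx] using this

lemma lt_of_mem_bendIdx {P : GridPath} {i : ℕ} (h : i ∈ P.bendIdx) : i + 1 < P.len := by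
  simp only [bendIdx, mem_filter, mem_range] at h; omega

lemma lt_of_mem_straightIdx {P : GridPath} {i : ℕ} (h : i ∈ P.straightIdx) : i + 1 < P.len := by
  simp only [straightIdx, mem_filter, mem_range] at h; omega

lemma step_mem_incident (P : GridPath) {i : ℕ} (h : i < P.len) :
    P.step i ∈ incident (P.pt i) (P.step i).2 := slot_mem_incident (P.adj_pt h)

lemma step_mem_incident_succ (P : GridPath) {i : ℕ} (h : i < P.len) :
    P.step i ∈ incident (P.pt (i + 1)) (P.step i).2 := by
  unfold step
  rw [slot_comm _ _ (P.adj_pt h)]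
  exact slot_mem_incident (P.adj_pt h).symm

lemma step_mem_slots (P : GridPath) {i : ℕ} (h : i < P.len) : P.step i ∈ P.slots :=
  mem_slots.2 ⟨i, h, rfl⟩

lemma pt_ne_succ (P : GridPath) {i : ℕ} (h : i < P.len) : P.pt i ≠ P.pt (i + 1) :=
  (P.adj_pt h).ne

/-- Two passages of a grid path through the same grid-point that share a grid-edge are equal. -/
lemma passage_unique (P : GridPath) {i j : ℕ} (hi : i + 1 < P.len) (hj : j + 1 < P.len)
    (hp : P.pt (i + 1) = P.pt (j + 1)) {e : (ℤ × ℤ) × Bool}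
    (h1 : e = P.step i ∨ e = P.step (i + 1)) (h2 : e = P.step j ∨ e = P.step (j + 1)) :
    i = j := by
  rcases h1 with rfl | rfl <;> rcases h2 with h | h
  · exact P.step_injective (by omega) (by omega) h
  · have := P.step_injective (by omega) (by omega) h
    subst this
    exact absurd hp.symm (P.pt_ne_succ (by omega))
  · have := P.step_injective (by omega) (by omega) h
    subst this
    exact absurd hp (P.pt_ne_succ (by omega))
  · have := P.step_injective (by omega) (by omega) h
    omega

lemma incident_of_straight (P : GridPath) {i : ℕ} (h : i ∈ P.straightIdx) :
    incident (P.pt (i + 1)) (P.step i).2 = {P.step i, P.step (i + 1)} := by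
  have hl := lt_of_mem_straightIdx h
  symm
  apply eq_of_subset_of_card_le
  · intro e he
    rcases mem_insert.1 he with rfl | he
    · exact P.step_mem_incident_succ (by omega)
    · rw [mem_singleton.1 he, (mem_filter.1 h).2]
      exact P.step_mem_incident hl
  · rw [card_pair]
    · exact card_le_two
    · intro h'
      have := P.step_injective (by omega) (by omega) h'
      omega

/-- The grid-points, with a direction, at which a grid path goes straight on. -/
noncomputable def straights (P : GridPath) : Finset ((ℤ × ℤ) × Bool) :=
  P.straightIdx.image fun i => (P.pt (i + 1), (P.step i).2)

lemma incident_subset_of_mem_straights {P : GridPath} {p : ℤ × ℤ} {d : Bool}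
    (h : (p, d) ∈ P.straights) : ∃ i ∈ P.straightIdx, P.pt (i + 1) = p ∧
      incident p d = {P.step i, P.step (i + 1)} := by
  obtain ⟨i, hi, h⟩ := mem_image.1 h
  obtain ⟨rfl, rfl⟩ := Prod.mk.inj h
  exact ⟨i, hi, rfl, P.incident_of_straight hi⟩

lemma incident_subset_slots {P : GridPath} {p : ℤ × ℤ} {d : Bool}
    (h : (p, d) ∈ P.straights) : incident p d ⊆ P.slots := by
  obtain ⟨i, hi, -, h⟩ := incident_subset_of_mem_straights h
  have := lt_of_mem_straightIdx hi
  rw [h]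
  intro e he
  rcases mem_insert.1 he with rfl | he
  · exact P.step_mem_slots (by omega)
  · rw [mem_singleton.1 he]
    exact P.step_mem_slots (by omega)

/-- A straight passage through `p` in direction `d` is identified with the edge it uses whose right
or upper end is `p`. -/
lemma straights_subset_slots (P : GridPath) : P.straights ⊆ P.slots := fun e h =>
  incident_subset_slots (p := e.1) (d := e.2) h (by simp [incident])

lemma card_straights (P : GridPath) : P.straights.card = P.straightIdx.card := by
  apply card_image_of_injOn
  intro i hi j hj h
  obtain ⟨h1, h2⟩ := Prod.mk.inj h
  have ei := P.incident_of_straight hi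
  have ej := P.incident_of_straight hj
  have hm : P.step i ∈ incident (P.pt (j + 1)) (P.step j).2 := by
    rw [← h1, ← h2, ei]; simp
  rw [ej] at hm
  exact P.passage_unique (lt_of_mem_straightIdx hi) (lt_of_mem_straightIdx hj) h1 (Or.inl rfl)
    (by simpa using hm)

/-- Each of the `len - 1` inner positions is a bend or a straight passage. Nonemptiness keeps the
subtraction from truncating. -/
lemma card_slots_eq (P : GridPath) (h : P.slots.Nonempty) :
    P.slots.card = P.straights.card + P.bends + 1 := by
  have h1 := P.card_bendIdx_add
  have h2 := h.card_pos
  rw [card_slots] at *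
  rw [bends_eq, card_straights]
  omega

/-- A common edge of maximal coordinate sum is no common straight passage, since otherwise both
paths would contain its successor. -/
lemma card_straights_inter_lt (P Q : GridPath) (h : (P.slots ∩ Q.slots).Nonempty) :
    (P.straights ∩ Q.straights).card < (P.slots ∩ Q.slots).card := by
  apply card_lt_card
  rw [ssubset_iff_of_subset (inter_subset_inter P.straights_subset_slots Q.straights_subset_slots)]
  obtain ⟨e, he, hmax⟩ := exists_max_image _ (fun e : (ℤ × ℤ) × Bool => e.1.1 + e.1.2) h
  refine ⟨e, he, fun hs => ?_⟩
  obtain ⟨h1, h2⟩ := mem_inter.1 hs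
  have hn : (e.1 + unitVec e.2, e.2) ∈ incident e.1 e.2 := by simp [incident]
  have := hmax _ (mem_inter.2 ⟨incident_subset_slots h1 hn, incident_subset_slots h2 hn⟩)
  revert this
  unfold unitVec
  split_ifs <;> simp

end GridPath

/-! ### Bends at a grid-point in an edge-disjoint family -/

namespace GridPath
variable {ι : Type*}

/-- The grid-edge of direction `d` at a bend. -/
noncomputable def bendSlot (P : ι → GridPath) (d : Bool) (t : Σ _ : ι, ℕ) : (ℤ × ℤ) × Bool :=
  if ((P t.1).step t.2).2 = d then (P t.1).step t.2 else (P t.1).step (t.2 + 1)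

lemma bendSlot_eq_or (P : ι → GridPath) (d : Bool) (t : Σ _ : ι, ℕ) :
    bendSlot P d t = (P t.1).step t.2 ∨ bendSlot P d t = (P t.1).step (t.2 + 1) := by
  unfold bendSlot; split_ifs <;> simp

variable [Fintype ι]

/-- The union of the slots of a family of grid paths. -/
noncomputable def famSlots (P : ι → GridPath) : Finset ((ℤ × ℤ) × Bool) :=
  univ.biUnion fun u => (P u).slots

/-- The union of the straight passages of a family of grid paths. -/
noncomputable def famStraights (P : ι → GridPath) : Finset ((ℤ × ℤ) × Bool) :=
  univ.biUnion fun u => (P u).straights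

/-- The bends of a family of grid paths. -/
noncomputable def famBends (P : ι → GridPath) : Finset (Σ _ : ι, ℕ) :=
  univ.sigma fun u => (P u).bendIdx

/-- The bends of a family of grid paths at a given grid-point. -/
noncomputable def famBendsAt (P : ι → GridPath) (p : ℤ × ℤ) : Finset (Σ _ : ι, ℕ) :=
  {t ∈ famBends P | (P t.1).pt (t.2 + 1) = p}

lemma mem_famBendsAt {P : ι → GridPath} {p : ℤ × ℤ} {t : Σ _ : ι, ℕ} :
    t ∈ famBendsAt P p ↔ t.2 ∈ (P t.1).bendIdx ∧ (P t.1).pt (t.2 + 1) = p := by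
  simp [famBendsAt, famBends]

lemma bendSlot_mem_incident {P : ι → GridPath} {p : ℤ × ℤ} {t : Σ _ : ι, ℕ}
    (h : t ∈ famBendsAt P p) (d : Bool) : bendSlot P d t ∈ incident p d := by
  obtain ⟨h1, rfl⟩ := mem_famBendsAt.1 h
  have hl := lt_of_mem_bendIdx h1
  have hne := (mem_filter.1 h1).2
  unfold bendSlot
  split_ifs with hd
  · subst hd
    exact (P t.1).step_mem_incident_succ (by omega)
  · have : ((P t.1).step (t.2 + 1)).2 = d := by
      revert hd hne
      generalize ((P t.1).step (t.2 + 1)).2 = x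
      generalize ((P t.1).step (t.2)).2 = y
      revert x y d
      decide
    subst this
    exact (P t.1).step_mem_incident hl

lemma bendSlot_mem_famSlots {P : ι → GridPath} {p : ℤ × ℤ} {t : Σ _ : ι, ℕ}
    (h : t ∈ famBendsAt P p) (d : Bool) : bendSlot P d t ∈ (P t.1).slots := by
  have hl := lt_of_mem_bendIdx (mem_famBendsAt.1 h).1
  rcases bendSlot_eq_or P d t with h | h <;> rw [h]
  · exact (P t.1).step_mem_slots (by omega)
  · exact (P t.1).step_mem_slots hl

lemma slots_subset_famSlots (P : ι → GridPath) (u : ι) : (P u).slots ⊆ famSlots P :=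
  subset_biUnion_of_mem (fun u => (P u).slots) (mem_univ u)

lemma incident_subset_famSlots {P : ι → GridPath} {p : ℤ × ℤ} {d : Bool}
    (h : (p, d) ∈ famStraights P) : incident p d ⊆ famSlots P := by
  obtain ⟨u, -, h⟩ := mem_biUnion.1 h
  exact (incident_subset_slots h).trans (slots_subset_famSlots P u)

lemma famStraights_subset_famSlots (P : ι → GridPath) : famStraights P ⊆ famSlots P :=
  biUnion_mono fun u _ => (P u).straights_subset_slots

lemma card_famBends (P : ι → GridPath) : (famBends P).card = ∑ u, (P u).bends := by
  simp [famBends, bends_eq]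

variable {P : ι → GridPath} (hP : ∀ u v, u ≠ v → Disjoint (P u).slots (P v).slots)
include hP

lemma card_famSlots (hne : ∀ u, (P u).slots.Nonempty) :
    (famSlots P).card = (famStraights P).card + (famBends P).card + Fintype.card ι := by
  rw [famSlots, famStraights, card_biUnion fun u _ v _ => hP u v, card_biUnion fun u _ v _ h =>
    (hP u v h).mono (P u).straights_subset_slots (P v).straights_subset_slots, card_famBends]
  simp [fun u => (P u).card_slots_eq (hne u), sum_add_distrib]

/-- A bend uses one edge of each direction. Edge-disjointness then forces equal paths, and the trail
property equal passages. -/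
lemma eq_of_bendSlot_eq {p : ℤ × ℤ} {d : Bool} {s t : Σ _ : ι, ℕ} (hs : s ∈ famBendsAt P p)
    (ht : t ∈ famBendsAt P p) (h : bendSlot P d s = bendSlot P d t) : s = t := by
  obtain ⟨u, i⟩ := s
  obtain ⟨v, j⟩ := t
  have huv : u = v := by
    by_contra huv
    refine disjoint_left.1 (hP u v huv) (bendSlot_mem_famSlots hs d) ?_
    rw [h]
    exact bendSlot_mem_famSlots ht d
  subst huv
  obtain ⟨h1, h2⟩ := mem_famBendsAt.1 hs
  obtain ⟨h3, h4⟩ := mem_famBendsAt.1 ht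
  have := (P u).passage_unique (lt_of_mem_bendIdx h1) (lt_of_mem_bendIdx h3) (h2.trans h4.symm)
    (bendSlot_eq_or P d ⟨u, i⟩) (h ▸ bendSlot_eq_or P d ⟨u, j⟩)
  dsimp only at this
  rw [this]

lemma image_bendSlot_card (p : ℤ × ℤ) (d : Bool) :
    ((famBendsAt P p).image (bendSlot P d)).card = (famBendsAt P p).card :=
  card_image_of_injOn fun _ hs _ ht h => eq_of_bendSlot_eq hP hs ht h

omit hP in
lemma image_bendSlot_subset (p : ℤ × ℤ) (d : Bool) :
    (famBendsAt P p).image (bendSlot P d) ⊆ incident p d :=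
  image_subset_iff.2 fun _ h => bendSlot_mem_incident h d

lemma card_famBendsAt_le (p : ℤ × ℤ) : (famBendsAt P p).card ≤ 2 := by
  rw [← image_bendSlot_card hP p true]
  exact (card_le_card (image_bendSlot_subset p true)).trans card_le_two

lemma incident_subset_of_two_bends {p : ℤ × ℤ} (h : 2 ≤ (famBendsAt P p).card) (d : Bool) :
    incident p d ⊆ famSlots P := by
  rw [← eq_of_subset_of_card_le (image_bendSlot_subset (P := P) p d)
    (by rw [image_bendSlot_card hP]; exact card_le_two.trans h)]
  refine image_subset_iff.2 fun t ht => ?_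
  exact slots_subset_famSlots P _ (bendSlot_mem_famSlots ht d)

/-- A straight passage takes both edges of its direction at `p`, leaving none for a bend. -/
lemma not_mem_famStraights {p : ℤ × ℤ} (h : (famBendsAt P p).Nonempty) (d : Bool) :
    (p, d) ∉ famStraights P := by
  intro hs
  obtain ⟨⟨u, i⟩, ht⟩ := h
  obtain ⟨v, -, hs⟩ := mem_biUnion.1 hs
  have hmem := bendSlot_mem_incident ht d
  have huv : u = v := by
    by_contra huv
    exact disjoint_left.1 (hP u v huv) (bendSlot_mem_famSlots ht d) (incident_subset_slots hs hmem)
  subst huv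
  obtain ⟨j, hj, hjp, hinc⟩ := incident_subset_of_mem_straights hs
  obtain ⟨h1, h2⟩ := mem_famBendsAt.1 ht
  rw [hinc] at hmem
  have := (P u).passage_unique (lt_of_mem_bendIdx h1) (lt_of_mem_straightIdx hj)
    (h2.trans hjp.symm) (bendSlot_eq_or P d ⟨u, i⟩) (by simpa using hmem)
  dsimp only at this h1
  subst this
  exact (mem_filter.1 h1).2 (mem_filter.1 hj).2

end GridPath

/-! ### Grid-lines and the surplus of segments over crossings -/

open GridPath

/-- The grid-line on which a slot lies. -/
def gridLine (e : (ℤ × ℤ) × Bool) : Bool × ℤ := (e.2, if e.2 then e.1.2 else e.1.1)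

lemma gridLine_of_mem_incident {e : (ℤ × ℤ) × Bool} {p : ℤ × ℤ} {d : Bool}
    (h : e ∈ incident p d) : gridLine e = (d, if d then p.2 else p.1) := by
  rcases mem_insert.1 h with rfl | h
  · rfl
  · rw [mem_singleton.1 h]
    cases d <;> simp [gridLine, unitVec]

/-- The slots in a finite set that have no successor in it on their grid-line. -/
def lastSlots (U : Finset ((ℤ × ℤ) × Bool)) : Finset ((ℤ × ℤ) × Bool) :=
  {e ∈ U | (e.1 + unitVec e.2, e.2) ∉ U}

lemma card_image_gridLine_le (U : Finset ((ℤ × ℤ) × Bool)) :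
    (U.image gridLine).card ≤ (lastSlots U).card := by
  refine le_trans (card_le_card (t := (lastSlots U).image gridLine) ?_) card_image_le
  intro l hl
  obtain ⟨e, he, rfl⟩ := mem_image.1 hl
  obtain ⟨f, hf, hmax⟩ := exists_max_image {f ∈ U | gridLine f = gridLine e}
    (fun e : (ℤ × ℤ) × Bool => e.1.1 + e.1.2) ⟨e, mem_filter.2 ⟨he, rfl⟩⟩
  obtain ⟨hfU, hfl⟩ := mem_filter.1 hf
  refine mem_image.2 ⟨f, mem_filter.2 ⟨hfU, fun hn => ?_⟩, hfl⟩
  have h1 : gridLine (f.1 + unitVec f.2, f.2) = gridLine e :=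
    (gridLine_of_mem_incident (p := f.1) (d := f.2) (by simp [incident])).trans hfl
  have := hmax _ (mem_filter.2 ⟨hn, h1⟩)
  revert this
  unfold unitVec
  split_ifs <;> simp

section Bipartite

variable {ι κ : Type*} [Fintype ι] [Fintype κ] {P : ι → GridPath} {Q : κ → GridPath}

/-- Distinct pairs have disjoint common edge sets, so the strict inequality of each pair adds up. -/
lemma card_inter_straights_add_le (hP : ∀ u v, u ≠ v → Disjoint (P u).slots (P v).slots)
    (hQ : ∀ u v, u ≠ v → Disjoint (Q u).slots (Q v).slots)
    (hPQ : ∀ u v, ((P u).slots ∩ (Q v).slots).Nonempty) :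
    (famStraights P ∩ famStraights Q).card + Fintype.card ι * Fintype.card κ ≤
      (famSlots P ∩ famSlots Q).card := by
  have h1 : (famSlots P ∩ famSlots Q) =
      (univ : Finset (ι × κ)).biUnion fun t => (P t.1).slots ∩ (Q t.2).slots := by
    ext e; simp [famSlots]
  have h2 : (famStraights P ∩ famStraights Q) =
      (univ : Finset (ι × κ)).biUnion fun t => (P t.1).straights ∩ (Q t.2).straights := by
    ext e; simp [famStraights]
  have h3 : (famStraights P ∩ famStraights Q).card ≤
      ∑ t : ι × κ, ((P t.1).straights ∩ (Q t.2).straights).card := by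
    rw [h2]
    exact card_biUnion_le
  rw [h1, card_biUnion, ← Fintype.card_prod, ← card_univ, card_eq_sum_ones univ]
  · refine (Nat.add_le_add_right h3 _).trans ?_
    rw [← sum_add_distrib]
    exact sum_le_sum fun t _ => card_straights_inter_lt _ _ (hPQ t.1 t.2)
  · rintro ⟨u, v⟩ - ⟨u', v'⟩ - h
    by_cases hu : u = u'
    · have hv : v ≠ v' := fun hv => h (by rw [hu, hv])
      exact (hQ v v' hv).mono inter_subset_right inter_subset_right
    · exact (hP u u' hu).mono inter_subset_left inter_subset_left

/-- The grid-points with at least three bends of two families of grid paths. -/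
noncomputable def crowded (P : ι → GridPath) (Q : κ → GridPath) : Finset (ℤ × ℤ) :=
  {p ∈ (famBends P).image fun t => (P t.1).pt (t.2 + 1) |
    3 ≤ (famBendsAt P p).card + (famBendsAt Q p).card}

lemma three_le_of_mem_crowded {p : ℤ × ℤ} (h : p ∈ crowded P Q) :
    3 ≤ (famBendsAt P p).card + (famBendsAt Q p).card := (mem_filter.1 h).2

lemma incident_subset_of_mem_crowded (hP : ∀ u v, u ≠ v → Disjoint (P u).slots (P v).slots)
    (hQ : ∀ u v, u ≠ v → Disjoint (Q u).slots (Q v).slots) {p : ℤ × ℤ} (h : p ∈ crowded P Q)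
    (d : Bool) : incident p d ⊆ famSlots P ∪ famSlots Q := by
  have := three_le_of_mem_crowded h
  by_cases h2 : 2 ≤ (famBendsAt P p).card
  · exact (incident_subset_of_two_bends hP h2 d).trans subset_union_left
  · exact (incident_subset_of_two_bends hQ (by omega) d).trans subset_union_right

lemma not_mem_straights_of_mem_crowded
    (hP : ∀ u v, u ≠ v → Disjoint (P u).slots (P v).slots)
    (hQ : ∀ u v, u ≠ v → Disjoint (Q u).slots (Q v).slots) {p : ℤ × ℤ} (h : p ∈ crowded P Q)
    (d : Bool) : (p, d) ∉ famStraights P ∪ famStraights Q := by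
  have := three_le_of_mem_crowded h
  have h1 := card_famBendsAt_le hP p
  have h2 := card_famBendsAt_le hQ p
  rw [mem_union, not_or]
  exact ⟨not_mem_famStraights hP (card_pos.1 (by omega)) d,
    not_mem_famStraights hQ (card_pos.1 (by omega)) d⟩

lemma card_lines_add_le (hP : ∀ u v, u ≠ v → Disjoint (P u).slots (P v).slots)
    (hQ : ∀ u v, u ≠ v → Disjoint (Q u).slots (Q v).slots) :
    ((famSlots P ∪ famSlots Q).image gridLine).card + 2 * (crowded P Q).card ≤
      ((famSlots P ∪ famSlots Q) \ (famStraights P ∪ famStraights Q)).card := by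
  set U := famSlots P ∪ famSlots Q with hU
  have hc : (crowded P Q ×ˢ (univ : Finset Bool)).card = 2 * (crowded P Q).card := by
    rw [card_product, card_univ, Fintype.card_bool, mul_comm]
  -- At a crowded point one family has two bends and so uses all four edges; thus the edge ending
  -- there has a successor.
  have hd : Disjoint (lastSlots U) (crowded P Q ×ˢ (univ : Finset Bool)) := by
    rw [disjoint_left]
    rintro ⟨p, d⟩ h1 h2
    exact (mem_filter.1 h1).2 (incident_subset_of_mem_crowded hP hQ (mem_product.1 h2).1 d
      (by simp [incident]))
  refine (Nat.add_le_add_right (card_image_gridLine_le U) _).trans ?_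
  rw [← hc, ← card_union_of_disjoint hd]
  refine card_le_card (union_subset ?_ ?_)
  · rintro ⟨p, d⟩ h
    obtain ⟨h1, h2⟩ := mem_filter.1 h
    refine mem_sdiff.2 ⟨h1, fun hs => h2 ?_⟩
    have hn : (p + unitVec d, d) ∈ incident p d := by simp [incident]
    rcases mem_union.1 hs with hs | hs
    · exact mem_union_left _ (incident_subset_famSlots hs hn)
    · exact mem_union_right _ (incident_subset_famSlots hs hn)
  · rintro ⟨p, d⟩ h
    have hp := (mem_product.1 h).1
    exact mem_sdiff.2 ⟨incident_subset_of_mem_crowded hP hQ hp d (by simp [incident]),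
      not_mem_straights_of_mem_crowded hP hQ hp d⟩

/-- The coordinates of the vertical (`d = false`) or horizontal (`d = true`) lines met by `U`. -/
def lineCoords (U : Finset ((ℤ × ℤ) × Bool)) (d : Bool) : Finset ℤ :=
  {l ∈ U.image gridLine | l.1 = d}.image Prod.snd

lemma card_lineCoords_add (U : Finset ((ℤ × ℤ) × Bool)) :
    (lineCoords U false).card + (lineCoords U true).card = (U.image gridLine).card := by
  have h : ∀ d, (lineCoords U d).card = #{l ∈ U.image gridLine | l.1 = d} := fun d =>
    card_image_of_injOn fun a ha b hb hab =>
      Prod.ext ((mem_filter.1 ha).2.trans (mem_filter.1 hb).2.symm) hab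
  rw [h, h, ← card_filter_add_card_filter_not (s := U.image gridLine) (fun l => l.1 = false)]
  simp

lemma mem_lineCoords_of_bend {t : Σ _ : ι, ℕ} {p : ℤ × ℤ} (h : t ∈ famBendsAt P p)
    {U : Finset ((ℤ × ℤ) × Bool)} (hU : famSlots P ⊆ U) (d : Bool) :
    (if d then p.2 else p.1) ∈ lineCoords U d :=
  mem_image.2 ⟨(d, if d then p.2 else p.1), mem_filter.2 ⟨mem_image.2 ⟨bendSlot P d t,
    hU (slots_subset_famSlots P _ (bendSlot_mem_famSlots h d)),
    gridLine_of_mem_incident (bendSlot_mem_incident h d)⟩, rfl⟩, rfl⟩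

lemma card_famBends_eq_sum {S : Finset (ℤ × ℤ)}
    (hS : ∀ t ∈ famBends P, (P t.1).pt (t.2 + 1) ∈ S) :
    (famBends P).card = ∑ p ∈ S, (famBendsAt P p).card :=
  card_eq_sum_card_fiberwise hS

lemma card_bends_le (hP : ∀ u v, u ≠ v → Disjoint (P u).slots (P v).slots)
    (hQ : ∀ u v, u ≠ v → Disjoint (Q u).slots (Q v).slots) :
    (famBends P).card + (famBends Q).card ≤
      2 * ((lineCoords (famSlots P ∪ famSlots Q) false).card *
        (lineCoords (famSlots P ∪ famSlots Q) true).card) + 2 * (crowded P Q).card := by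
  set U := famSlots P ∪ famSlots Q with hU
  set S := lineCoords U false ×ˢ lineCoords U true with hS
  have hSP : ∀ t ∈ famBends P, (P t.1).pt (t.2 + 1) ∈ S := fun t ht => by
    have := mem_lineCoords_of_bend (P := P) (mem_filter.2 ⟨ht, rfl⟩)
      (U := U) subset_union_left
    exact mem_product.2 ⟨by simpa using this false, by simpa using this true⟩
  have hSQ : ∀ t ∈ famBends Q, (Q t.1).pt (t.2 + 1) ∈ S := fun t ht => by
    have := mem_lineCoords_of_bend (P := Q) (mem_filter.2 ⟨ht, rfl⟩)
      (U := U) subset_union_right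
    exact mem_product.2 ⟨by simpa using this false, by simpa using this true⟩
  rw [card_famBends_eq_sum hSP, card_famBends_eq_sum hSQ, ← sum_add_distrib]
  have hle : ∀ p ∈ S, (famBendsAt P p).card + (famBendsAt Q p).card ≤
      2 + if p ∈ crowded P Q then 2 else 0 := by
    intro p _
    have h1 := card_famBendsAt_le hP p
    have h2 := card_famBendsAt_le hQ p
    split_ifs with h
    · omega
    · by_contra h3
      refine h (mem_filter.2 ⟨?_, by omega⟩)
      -- Of three bends at most two belong to `Q`, so one belongs to `P`, as `crowded` requires.
      obtain ⟨t, ht⟩ := card_pos.1 (show 0 < (famBendsAt P p).card by omega)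
      exact mem_image.2 ⟨t, mem_filter.1 ht⟩
  refine (sum_le_sum hle).trans ?_
  rw [sum_add_distrib, sum_const, ← sum_filter, sum_const, hS, card_product, smul_eq_mul,
    smul_eq_mul, mul_comm _ 2, mul_comm _ 2]
  gcongr
  intro p hp
  exact (mem_filter.1 hp).2

/-- The counting behind the lower bound: `D` is the surplus of segments over crossings. -/
lemma exists_surplus [Nonempty ι] [Nonempty κ]
    (hP : ∀ u v, u ≠ v → Disjoint (P u).slots (P v).slots)
    (hQ : ∀ u v, u ≠ v → Disjoint (Q u).slots (Q v).slots)
    (hPQ : ∀ u v, ((P u).slots ∩ (Q v).slots).Nonempty) :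
    ∃ D : ℕ, 1 ≤ D ∧ D + Fintype.card ι * Fintype.card κ ≤
        (∑ u, (P u).bends + ∑ v, (Q v).bends) + (Fintype.card ι + Fintype.card κ) ∧
      2 * (∑ u, (P u).bends + ∑ v, (Q v).bends) ≤ D ^ 2 := by
  have u₀ : ι := Classical.arbitrary ι
  have v₀ : κ := Classical.arbitrary κ
  have hlines := card_lines_add_le hP hQ
  have hbends := card_bends_le hP hQ
  have hcoord := card_lineCoords_add (famSlots P ∪ famSlots Q)
  have hcross := card_inter_straights_add_le hP hQ hPQ
  have hslP := card_famSlots hP fun u => (hPQ u v₀).mono inter_subset_left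
  have hslQ := card_famSlots hQ fun v => (hPQ u₀ v).mono inter_subset_right
  have hE := card_union_add_card_inter (famSlots P) (famSlots Q)
  have hS := card_union_add_card_inter (famStraights P) (famStraights Q)
  have hD := card_sdiff_add_card_eq_card (union_subset_union (famStraights_subset_famSlots P)
    (famStraights_subset_famSlots Q))
  have hpos : 0 < ((famSlots P ∪ famSlots Q).image gridLine).card := by
    obtain ⟨e, he⟩ := hPQ u₀ v₀
    exact card_pos.2 ⟨gridLine e, mem_image_of_mem _ (mem_union_left _
      (slots_subset_famSlots P u₀ (mem_inter.1 he).1))⟩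
  rw [← card_famBends, ← card_famBends]
  refine ⟨((famSlots P ∪ famSlots Q) \ (famStraights P ∪ famStraights Q)).card, ?_, ?_, ?_⟩
  · omega
  · omega
  · generalize ((famSlots P ∪ famSlots Q) \ (famStraights P ∪ famStraights Q)).card = D at *
    generalize ((famSlots P ∪ famSlots Q).image gridLine).card = l at *
    generalize (lineCoords (famSlots P ∪ famSlots Q) false).card = x at *
    generalize (lineCoords (famSlots P ∪ famSlots Q) true).card = y at *
    have h1 : 2 * ((famBends P).card + (famBends Q).card) ≤ 4 * (x * y) + 2 * (D - l) := by omega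
    -- As $l \ge 1$, $4xy + 2c \le l^2 + 2c \le (l + c)^2$.
    obtain ⟨c, rfl⟩ : ∃ c, D = l + c := ⟨D - l, by omega⟩
    rw [Nat.add_sub_cancel_left] at h1
    subst hcoord
    have h2 : 4 * (x * y) ≤ (x + y) ^ 2 := by
      zify; nlinarith [sq_nonneg ((x : ℤ) - y)]
    nlinarith

end Bipartite

/-! ### Grid paths from functions -/

/-- The walk through `f 0, …, f n`. -/
noncomputable def walkOfFun : ∀ (f : ℕ → ℤ × ℤ) (_ : ∀ i, planeGrid.Adj (f i) (f (i + 1))) (n : ℕ),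
    planeGrid.Walk (f 0) (f n)
  | _, _, 0 => .nil
  | f, h, n + 1 => .cons (h 0) (walkOfFun (fun i => f (i + 1)) (fun i => h (i + 1)) n)

lemma length_walkOfFun (f : ℕ → ℤ × ℤ) (h : ∀ i, planeGrid.Adj (f i) (f (i + 1))) (n : ℕ) :
    (walkOfFun f h n).length = n := by
  induction n generalizing f with
  | zero => rfl
  | succ n ih => simp [walkOfFun, ih]

lemma getVert_walkOfFun (f : ℕ → ℤ × ℤ) (h : ∀ i, planeGrid.Adj (f i) (f (i + 1))) {n i : ℕ}
    (hi : i ≤ n) : (walkOfFun f h n).getVert i = f i := by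
  induction n generalizing f i with
  | zero => simp [walkOfFun, Nat.le_zero.1 hi]
  | succ n ih =>
    cases i with
    | zero => simp
    | succ i => simpa [walkOfFun] using ih (fun i => f (i + 1)) (fun i => h (i + 1)) (by omega)

namespace GridPath

/-- The grid path through `f 0, …, f n`. -/
noncomputable def ofFun (f : ℕ → ℤ × ℤ) (h : ∀ i, planeGrid.Adj (f i) (f (i + 1)))
    (hinj : Function.Injective fun i => slot (f i) (f (i + 1))) (n : ℕ) : GridPath where
  source := f 0
  target := f n
  walk := walkOfFun f h n
  isTrail := by
    rw [SimpleGraph.Walk.isTrail_def, edges_eq, length_walkOfFun]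
    refine (List.nodup_map_iff_inj_on List.nodup_range).2 fun i hi j hj hij => ?_
    rw [List.mem_range] at hi hj
    rw [getVert_walkOfFun f h (by omega), getVert_walkOfFun f h (by omega),
      getVert_walkOfFun f h (by omega), getVert_walkOfFun f h (by omega)] at hij
    exact hinj ((slot_eq_iff (h i) (h j)).2 hij)

variable {f : ℕ → ℤ × ℤ} {h : ∀ i, planeGrid.Adj (f i) (f (i + 1))}
  {hinj : Function.Injective fun i => slot (f i) (f (i + 1))} {n : ℕ}

lemma len_ofFun : (ofFun f h hinj n).len = n := length_walkOfFun f h n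

lemma step_ofFun {i : ℕ} (hi : i < n) : (ofFun f h hinj n).step i = slot (f i) (f (i + 1)) := by
  simp only [step, pt, ofFun]
  rw [getVert_walkOfFun f h (by omega), getVert_walkOfFun f h (by omega)]

lemma mem_slots_ofFun {e : (ℤ × ℤ) × Bool} :
    e ∈ (ofFun f h hinj n).slots ↔ ∃ i < n, slot (f i) (f (i + 1)) = e := by
  rw [mem_slots, len_ofFun]
  exact exists_congr fun i => and_congr_right fun hi => by rw [step_ofFun hi]

/-- A path that changes direction only after an even number of edges has few bends. -/
lemma bends_ofFun_le {k : ℕ} (heven : ∀ i, Even i →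
      (slot (f i) (f (i + 1))).2 = (slot (f (i + 1)) (f (i + 1 + 1))).2) :
    (ofFun f h hinj (2 * k + 2)).bends ≤ k := by
  rw [bends_eq]
  have hs : (ofFun f h hinj (2 * k + 2)).bendIdx ⊆ (range k).image fun j => 2 * j + 1 := by
    intro i hi
    have hl := lt_of_mem_bendIdx hi
    have hne := (mem_filter.1 hi).2
    rw [len_ofFun] at hl
    rw [step_ofFun (by omega), step_ofFun hl] at hne
    obtain ⟨j, hj⟩ := Nat.not_even_iff_odd.1 fun he => hne (heven i he)
    exact mem_image.2 ⟨j, mem_range.2 (by omega), hj.symm⟩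
  exact (card_le_card hs).trans (card_image_le.trans_eq (card_range k))

/-- The grid path through `g s, …, g (s + n)`. -/
noncomputable def ofIntFun (g : ℤ → ℤ × ℤ) (h : ∀ m, planeGrid.Adj (g m) (g (m + 1)))
    (hinj : Function.Injective fun m => slot (g m) (g (m + 1))) (s : ℤ) (n : ℕ) : GridPath :=
  ofFun (fun i => g (s + i)) (fun i => by simpa [add_assoc] using h (s + i))
    (fun i j hij => by
      have := @hinj (s + i) (s + j) (by simpa [add_assoc] using hij)
      omega) n

variable {g : ℤ → ℤ × ℤ} {hg : ∀ m, planeGrid.Adj (g m) (g (m + 1))}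
  {hginj : Function.Injective fun m => slot (g m) (g (m + 1))} {s : ℤ}

lemma mem_slots_ofIntFun {e : (ℤ × ℤ) × Bool} : e ∈ (ofIntFun g hg hginj s n).slots ↔
    ∃ m, s ≤ m ∧ m < s + n ∧ slot (g m) (g (m + 1)) = e := by
  refine mem_slots_ofFun.trans ?_
  constructor
  · rintro ⟨i, hi, h⟩
    exact ⟨s + i, by omega, by omega, by rw [← h, add_assoc]; rfl⟩
  · rintro ⟨m, h1, h2, h⟩
    obtain ⟨i, rfl⟩ := Int.le.dest h1
    exact ⟨i, by omega, by rw [← h, add_assoc]; rfl⟩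

lemma bends_ofIntFun_le {k : ℕ} (hs : Even s) (heven : ∀ m, Even m →
      (slot (g m) (g (m + 1))).2 = (slot (g (m + 1)) (g (m + 1 + 1))).2) :
    (ofIntFun g hg hginj s (2 * k + 2)).bends ≤ k := by
  refine bends_ofFun_le fun i hi => ?_
  simpa [add_assoc] using heven (s + i) (hs.add (by exact_mod_cast hi))

end GridPath

/-! ### Staircases representing $K_{2k,2k}$ -/

/-- The abscissa of a staircase with steps of length two after `n` edges. -/
def stair (n : ℤ) : ℤ := 2 * (n / 4) + min (n % 4) 2

/-- An ascending staircase. -/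
def upPt (ε a n : ℤ) : ℤ × ℤ := (stair n - ε, stair (n - 2) - ε - 2 * a)

/-- A descending staircase. -/
def downPt (ε b n : ℤ) : ℤ × ℤ := (stair n - ε, 2 * b - 1 + ε - stair (n - 2))

lemma stair_step (n : ℤ) :
    (n % 4 < 2 ∧ stair (n + 1) = stair n + 1 ∧ stair (n + 1 - 2) = stair (n - 2)) ∨
      (2 ≤ n % 4 ∧ stair (n + 1) = stair n ∧ stair (n + 1 - 2) = stair (n - 2) + 1) := by
  unfold stair
  omega

lemma upPt_adj (ε a n : ℤ) : planeGrid.Adj (upPt ε a n) (upPt ε a (n + 1)) := by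
  rw [planeGrid_adj_iff]
  have := stair_step n
  simp only [upPt]
  omega

lemma downPt_adj (ε b n : ℤ) : planeGrid.Adj (downPt ε b n) (downPt ε b (n + 1)) := by
  rw [planeGrid_adj_iff]
  have := stair_step n
  simp only [downPt]
  omega

lemma slot_upPt (ε a n : ℤ) : slot (upPt ε a n) (upPt ε a (n + 1)) =
    if n % 4 < 2 then ((stair n - ε + 1, stair (n - 2) - ε - 2 * a), true)
    else ((stair n - ε, stair (n - 2) - ε - 2 * a + 1), false) := by
  rcases stair_step n with ⟨h, h1, h2⟩ | ⟨h, h1, h2⟩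
  · rw [if_pos h]
    simp [slot, upPt, h1, h2]
    omega
  · rw [if_neg (by omega), slot, if_neg (by simp [upPt, h2])]
    simp [upPt, h2]
    omega

lemma slot_downPt (ε b n : ℤ) : slot (downPt ε b n) (downPt ε b (n + 1)) =
    if n % 4 < 2 then ((stair n - ε + 1, 2 * b - 1 + ε - stair (n - 2)), true)
    else ((stair n - ε, 2 * b - 1 + ε - stair (n - 2)), false) := by
  rcases stair_step n with ⟨h, h1, h2⟩ | ⟨h, h1, h2⟩
  · rw [if_pos h]
    simp [slot, downPt, h1, h2]
    omega
  · rw [if_neg (by omega), slot, if_neg (by simp [downPt, h2])]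
    simp [downPt, h2]
    omega

/-- Horizontal segments have ordinate, and vertical ones abscissa, congruent to `ε` modulo 2, which
separates the two classes. Within a class, position on the row or column determines the rest. -/
lemma eq_of_slot_upPt_eq {ε ε' a a' n n' : ℤ} (hε : 0 ≤ ε ∧ ε ≤ 1) (hε' : 0 ≤ ε' ∧ ε' ≤ 1)
    (h : slot (upPt ε a n) (upPt ε a (n + 1)) = slot (upPt ε' a' n') (upPt ε' a' (n' + 1))) :
    ε = ε' ∧ a = a' ∧ n = n' := by
  rw [slot_upPt, slot_upPt] at h
  unfold stair at h
  split_ifs at h <;> simp only [Prod.mk.injEq, and_true, and_false, Bool.true_eq_false,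
    Bool.false_eq_true] at h
  · omega
  · omega

lemma eq_of_slot_downPt_eq {ε ε' b b' n n' : ℤ} (hε : 0 ≤ ε ∧ ε ≤ 1) (hε' : 0 ≤ ε' ∧ ε' ≤ 1)
    (h : slot (downPt ε b n) (downPt ε b (n + 1)) =
      slot (downPt ε' b' n') (downPt ε' b' (n' + 1))) :
    ε = ε' ∧ b = b' ∧ n = n' := by
  rw [slot_downPt, slot_downPt] at h
  unfold stair at h
  split_ifs at h <;> simp only [Prod.mk.injEq, and_true, and_false, Bool.true_eq_false,
    Bool.false_eq_true] at h
  · omega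
  · omega

/-- The shared edge is vertical if `ε = δ` and horizontal otherwise; the parity of `a + b` fixes the
parameters. The bounds serve to place it inside the finite pieces used later. -/
lemma exists_slot_upPt_eq_slot_downPt {ε δ : ℤ} (hε : 0 ≤ ε ∧ ε ≤ 1) (hδ : 0 ≤ δ ∧ δ ≤ 1)
    (a b : ℤ) : ∃ n m : ℤ, slot (upPt ε a n) (upPt ε a (n + 1)) =
        slot (downPt δ b m) (downPt δ b (m + 1)) ∧
      2 * (a + b + ε) - 1 ≤ n ∧ n ≤ 2 * (a + b + ε) ∧
      2 * (a + b + δ) - 1 ≤ m ∧ m ≤ 2 * (a + b + δ) := by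
  obtain ⟨σ, hσ⟩ : ∃ σ, σ = a + b := ⟨_, rfl⟩
  have key : ∃ n m : ℤ, ((n % 4 < 2 ∧ m % 4 < 2 ∧ stair n - ε + 1 = stair m - δ + 1 ∧
      stair (n - 2) - ε - 2 * a = 2 * b - 1 + δ - stair (m - 2)) ∨
      (2 ≤ n % 4 ∧ 2 ≤ m % 4 ∧ stair n - ε = stair m - δ ∧
      stair (n - 2) - ε - 2 * a + 1 = 2 * b - 1 + δ - stair (m - 2))) ∧
      2 * (a + b + ε) - 1 ≤ n ∧ n ≤ 2 * (a + b + ε) ∧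
      2 * (a + b + δ) - 1 ≤ m ∧ m ≤ 2 * (a + b + δ) := by
    unfold stair
    obtain rfl | rfl : ε = 0 ∨ ε = 1 := by omega
    · obtain rfl | rfl : δ = 0 ∨ δ = 1 := by omega
      · rcases Int.emod_two_eq_zero_or_one σ with h | h
        · exact ⟨2 * σ - 1, 2 * σ - 1, by omega⟩
        · exact ⟨2 * σ, 2 * σ, by omega⟩
      · rcases Int.emod_two_eq_zero_or_one σ with h | h
        · exact ⟨2 * σ, 2 * σ + 1, by omega⟩
        · exact ⟨2 * σ - 1, 2 * σ + 2, by omega⟩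
    · obtain rfl | rfl : δ = 0 ∨ δ = 1 := by omega
      · rcases Int.emod_two_eq_zero_or_one σ with h | h
        · exact ⟨2 * σ + 1, 2 * σ, by omega⟩
        · exact ⟨2 * σ + 2, 2 * σ - 1, by omega⟩
      · rcases Int.emod_two_eq_zero_or_one σ with h | h
        · exact ⟨2 * σ + 2, 2 * σ + 2, by omega⟩
        · exact ⟨2 * σ + 1, 2 * σ + 1, by omega⟩
  obtain ⟨n, m, h, hr⟩ := key
  refine ⟨n, m, ?_, hr⟩
  rw [slot_upPt, slot_downPt]
  rcases h with ⟨h1, h2, h3, h4⟩ | ⟨h1, h2, h3, h4⟩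
  · rw [if_pos h1, if_pos h2, h3, h4]
  · rw [if_neg (by omega), if_neg (by omega), h3, h4]

/-- The parameter at which the `i`-th staircase starts. -/
def stairStart (i : ℕ) : ℤ := 2 * ((i / 2 : ℕ) : ℤ) + 2 * ((i % 2 : ℕ) : ℤ) - 2

lemma even_stairStart (i : ℕ) : Even (stairStart i) := by
  rw [Int.even_iff, stairStart]
  omega

lemma parity_bounds (i : ℕ) : (0 : ℤ) ≤ ((i % 2 : ℕ) : ℤ) ∧ ((i % 2 : ℕ) : ℤ) ≤ 1 := by omega

/-- The `i`-th ascending staircase with `k` bends. -/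
noncomputable def upPath (k i : ℕ) : GridPath :=
  GridPath.ofIntFun (upPt (i % 2 : ℕ) (i / 2 : ℕ)) (upPt_adj _ _)
    (fun _ _ h => (eq_of_slot_upPt_eq (parity_bounds i) (parity_bounds i) h).2.2)
    (stairStart i) (2 * k + 2)

/-- The `i`-th descending staircase with `k` bends. -/
noncomputable def downPath (k i : ℕ) : GridPath :=
  GridPath.ofIntFun (downPt (i % 2 : ℕ) (i / 2 : ℕ)) (downPt_adj _ _)
    (fun _ _ h => (eq_of_slot_downPt_eq (parity_bounds i) (parity_bounds i) h).2.2)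
    (stairStart i) (2 * k + 2)

open GridPath

lemma bends_upPath_le (k i : ℕ) : (upPath k i).bends ≤ k := by
  refine bends_ofIntFun_le (even_stairStart i) fun m hm => ?_
  rw [slot_upPt, slot_upPt]
  obtain ⟨l, rfl⟩ := hm
  split_ifs <;> first | rfl | (exfalso; omega)

lemma bends_downPath_le (k i : ℕ) : (downPath k i).bends ≤ k := by
  refine bends_ofIntFun_le (even_stairStart i) fun m hm => ?_
  rw [slot_downPt, slot_downPt]
  obtain ⟨l, rfl⟩ := hm
  split_ifs <;> first | rfl | (exfalso; omega)

lemma eq_of_upPath_inter {k i j : ℕ} (h : ((upPath k i).slots ∩ (upPath k j).slots).Nonempty) :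
    i = j := by
  obtain ⟨e, he⟩ := h
  obtain ⟨h1, h2⟩ := mem_inter.1 he
  obtain ⟨n, -, -, rfl⟩ := mem_slots_ofIntFun.1 h1
  obtain ⟨m, -, -, h⟩ := mem_slots_ofIntFun.1 h2
  have := eq_of_slot_upPt_eq (parity_bounds j) (parity_bounds i) h
  omega

lemma eq_of_downPath_inter {k i j : ℕ}
    (h : ((downPath k i).slots ∩ (downPath k j).slots).Nonempty) : i = j := by
  obtain ⟨e, he⟩ := h
  obtain ⟨h1, h2⟩ := mem_inter.1 he
  obtain ⟨n, -, -, rfl⟩ := mem_slots_ofIntFun.1 h1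
  obtain ⟨m, -, -, h⟩ := mem_slots_ofIntFun.1 h2
  have := eq_of_slot_downPt_eq (parity_bounds j) (parity_bounds i) h
  omega

/-- Both `i / 2` and `j / 2` are below `k`, so the `2 * k + 2` edges from `stairStart` on reach the
meeting parameters. -/
lemma upPath_inter_downPath {k i j : ℕ} (hi : i < 2 * k) (hj : j < 2 * k) :
    ((upPath k i).slots ∩ (downPath k j).slots).Nonempty := by
  obtain ⟨n, m, h, h1, h2, h3, h4⟩ := exists_slot_upPt_eq_slot_downPt (parity_bounds i)
    (parity_bounds j) (i / 2 : ℕ) (j / 2 : ℕ)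
  refine ⟨_, mem_inter.2 ⟨mem_slots_ofIntFun.2 ⟨n, ?_, ?_, rfl⟩,
    mem_slots_ofIntFun.2 ⟨m, ?_, ?_, h.symm⟩⟩⟩ <;> unfold stairStart <;> omega

lemma exists_isBendRepresentation {m n k : ℕ} (hm : m ≤ 2 * k) (hn : n ≤ 2 * k) :
    ∃ P, IsBendRepresentation (completeBipartiteGraph (Fin m) (Fin n)) k P := by
  refine ⟨Sum.elim (fun i => upPath k i) (fun j => downPath k j), ?_, ?_⟩
  · rintro (i | j)
    · exact bends_upPath_le k i
    · exact bends_downPath_le k j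
  · rintro (i | i) (j | j) hij <;> rw [edgeSet_inter_nonempty_iff]
    · simpa using fun h => hij (congrArg Sum.inl (Fin.ext (eq_of_upPath_inter h)))
    · simpa using upPath_inter_downPath (by omega) (by omega)
    · rw [inter_comm]
      simpa using upPath_inter_downPath (by omega) (by omega)
    · simpa using fun h => hij (congrArg Sum.inr (Fin.ext (eq_of_downPath_inter h)))

/-! ### Lower bounds and bend-numbers -/

lemma IsBendRepresentation.exists_surplus {m n k : ℕ} (hm : 0 < m) (hn : 0 < n)
    {P : Fin m ⊕ Fin n → GridPath}
    (h : IsBendRepresentation (completeBipartiteGraph (Fin m) (Fin n)) k P) :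
    ∃ D : ℕ, 1 ≤ D ∧ D + m * n ≤ (k + 1) * (m + n) ∧ 2 * (k * (m + n)) ≤ D ^ 2 := by
  have : Nonempty (Fin m) := ⟨⟨0, hm⟩⟩
  have : Nonempty (Fin n) := ⟨⟨0, hn⟩⟩
  obtain ⟨D, h1, h2, h3⟩ := _root_.exists_surplus (P := fun i => P (.inl i))
    (Q := fun j => P (.inr j))
    (fun u v huv => by
      have := (h.2 (.inl u) (.inl v) (by simpa using huv)).not
      rw [GridPath.edgeSet_inter_nonempty_iff, not_nonempty_iff_eq_empty,
        ← disjoint_iff_inter_eq_empty] at this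
      exact this.1 (by simp))
    (fun u v huv => by
      have := (h.2 (.inr u) (.inr v) (by simpa using huv)).not
      rw [GridPath.edgeSet_inter_nonempty_iff, not_nonempty_iff_eq_empty,
        ← disjoint_iff_inter_eq_empty] at this
      exact this.1 (by simp))
    (fun u v => by
      rw [← GridPath.edgeSet_inter_nonempty_iff]
      exact (h.2 (.inl u) (.inr v) (by simp)).1 (by simp))
  have hA : ∑ i, (P (.inl i)).bends ≤ m * k := by
    simpa using sum_le_card_nsmul univ _ k fun i _ => h.1 (.inl i)
  have hB : ∑ j, (P (.inr j)).bends ≤ n * k := by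
    simpa using sum_le_card_nsmul univ _ k fun j _ => h.1 (.inr j)
  simp only [Fintype.card_fin] at h2
  -- Here `c` counts the bends left unused. Adding it to `D` is harmless: $D^2 + 2c \le (D + c)^2$
  -- because $D \ge 1$.
  obtain ⟨c, hc⟩ : ∃ c, k * (m + n) = ∑ i, (P (.inl i)).bends + ∑ j, (P (.inr j)).bends + c :=
    Nat.exists_eq_add_of_le (by linarith [hA, hB])
  refine ⟨D + c, by omega, by linarith, ?_⟩
  rw [hc]
  nlinarith

lemma bound_of_isBendRepresentation {m n k : ℕ} (hm : 0 < m) (hn : 0 < n)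
    {P : Fin m ⊕ Fin n → GridPath}
    (h : IsBendRepresentation (completeBipartiteGraph (Fin m) (Fin n)) k P) :
    (m : ℝ) * n + √(2 * k * (m + n)) ≤ ((k : ℝ) + 1) * (m + n) := by
  obtain ⟨D, -, h2, h3⟩ := h.exists_surplus hm hn
  have h4 : √(2 * k * (m + n) : ℝ) ≤ D := by
    rw [Real.sqrt_le_left (by positivity), mul_assoc]
    exact_mod_cast h3
  have h5 : (D : ℝ) + m * n ≤ (k + 1) * (m + n) := by exact_mod_cast h2
  linarith

lemma half_le_of_isBendRepresentation {m k : ℕ} (hm : 3 ≤ m)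
    {P : Fin m ⊕ Fin m → GridPath}
    (h : IsBendRepresentation (completeBipartiteGraph (Fin m) (Fin m)) k P) : m ≤ 2 * k := by
  obtain ⟨D, h1, h2, h3⟩ := h.exists_surplus (by omega) (by omega)
  by_contra! hk
  obtain ⟨c, rfl⟩ := Nat.exists_eq_add_of_lt hk
  rcases c with _ | c
  -- Here $m = 2k + 1$, so $D \le m$ and $4km \le D^2 \le m^2$ give $4k \le 2k + 1$, against $m \ge
  -- 3$.
  · have : D ≤ 2 * k + 1 := by nlinarith
    nlinarith
  -- Here $m \ge 2k + 2$, so $D \le m(2k + 2 - m) \le 0$.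
  · nlinarith

lemma bendNumber_eq {V : Type*} {G : SimpleGraph V} {k : ℕ}
    (h : ∃ P, IsBendRepresentation G k P) (hle : ∀ l P, IsBendRepresentation G l P → k ≤ l) :
    bendNumber G = k :=
  le_antisymm (iInf₂_le k h) (le_iInf₂ fun l ⟨P, hP⟩ => Nat.cast_le.2 (hle l P hP))

lemma bendNumber_completeBipartiteGraph {m : ℕ} (hm : 3 ≤ m) :
    bendNumber (completeBipartiteGraph (Fin m) (Fin m)) = ((⌈(m : ℚ) / 2⌉₊ : ℕ) : ℕ∞) := by
  have hceil : ∀ k : ℕ, ⌈(m : ℚ) / 2⌉₊ ≤ k ↔ m ≤ 2 * k := fun k => by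
    rw [Nat.ceil_le, div_le_iff₀ two_pos, mul_comm]
    exact_mod_cast Iff.rfl
  have := (hceil _).1 le_rfl
  exact bendNumber_eq (exists_isBendRepresentation this this) fun l P hP =>
    (hceil l).2 (half_le_of_isBendRepresentation hm hP)

lemma bendNumber_completeBipartiteGraph_two :
    bendNumber (completeBipartiteGraph (Fin 2) (Fin 2)) = (1 : ℕ) := by
  refine bendNumber_eq (exists_isBendRepresentation le_rfl le_rfl) fun l P hP => ?_
  obtain ⟨D, h1, h2, -⟩ := hP.exists_surplus two_pos two_pos
  omega

lemma IsBendRepresentation.comp {V W : Type*} {G : SimpleGraph V} {H : SimpleGraph W} {k : ℕ}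
    {P : W → GridPath} (h : IsBendRepresentation H k P) (f : G ↪g H) :
    IsBendRepresentation G k (P ∘ f) :=
  ⟨fun v => h.1 (f v), fun v w hvw => by
    rw [← f.map_adj_iff]
    exact h.2 _ _ (f.injective.ne hvw)⟩

lemma bendNumber_congr {V W : Type*} {G : SimpleGraph V} {H : SimpleGraph W} (f : G ≃g H) :
    bendNumber G = bendNumber H := by
  have : {k : ℕ | ∃ P : V → GridPath, IsBendRepresentation G k P} =
      {k : ℕ | ∃ P : W → GridPath, IsBendRepresentation H k P} :=
    Set.ext fun k => ⟨fun ⟨P, hP⟩ => ⟨_, hP.comp f.symm.toEmbedding⟩,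
      fun ⟨P, hP⟩ => ⟨_, hP.comp f.toEmbedding⟩⟩
  unfold bendNumber
  rw [this]

lemma exists_bendNumber_eq_of_fintype {V : Type*} [Fintype V] (H : SimpleGraph V) :
    ∃ (n : ℕ) (G : SimpleGraph (Fin n)), bendNumber G = bendNumber H :=
  ⟨_, _, bendNumber_congr (SimpleGraph.Iso.comap (Fintype.equivFin V).symm H)⟩

theorem exists_bendNumber_eq (k : ℕ) :
    ∃ (n : ℕ) (G : SimpleGraph (Fin n)), bendNumber G = (k : ℕ∞) := by
  rcases k with _ | _ | k
  · exact ⟨0, ⊥, bendNumber_eq ⟨fun v => v.elim0, fun v => v.elim0, fun v => v.elim0⟩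
      fun _ _ _ => Nat.zero_le _⟩
  -- $K_{2,2}$ falls outside the range $m \ge 3$; for it $D \ge 1$ alone rules out $k = 0$.
  · rw [← bendNumber_completeBipartiteGraph_two]
    exact exists_bendNumber_eq_of_fintype _
  · have h := bendNumber_completeBipartiteGraph (m := 2 * (k + 1 + 1)) (by omega)
    have hc : ((2 * (k + 1 + 1) : ℕ) : ℚ) / 2 = ((k + 1 + 1 : ℕ) : ℚ) := by
      push_cast; ring
    rw [hc, Nat.ceil_natCast] at h
    rw [← h]
    exact exists_bendNumber_eq_of_fintype _

theorem mainTheorem1 :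
    (∀ m : ℕ, 3 ≤ m →
      bendNumber (completeBipartiteGraph (Fin m) (Fin m)) = ((⌈(m : ℚ) / 2⌉₊ : ℕ) : ℕ∞)) ∧
    (∀ m n k : ℕ, 3 ≤ m → m ≤ n →
      (∃ P : Fin m ⊕ Fin n → GridPath,
        IsBendRepresentation (completeBipartiteGraph (Fin m) (Fin n)) k P) →
      (m : ℝ) * n + √(2 * k * (m + n)) ≤ ((k : ℝ) + 1) * (m + n)) ∧
    (∀ k : ℕ, ∃ (n : ℕ) (G : SimpleGraph (Fin n)), bendNumber G = (k : ℕ∞)) :=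
  ⟨fun _ hm => bendNumber_completeBipartiteGraph hm,
    fun _ _ _ hm hmn ⟨_, hP⟩ => bound_of_isBendRepresentation (by omega) (by omega) hP,
    exists_bendNumber_eq⟩
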